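/- Work in the field $\mathbb{Q}(q)$ of rational functions in $q$, and write $[n]_q=\frac{q^n-1}{q-1}$. The $q$-Bernoulli--Carlitz numbers $\beta_n\in\mathbb{Q}(q)$ ($n\ge 0$) are defined by the relations $$q\sum_{k=0}^{n}\binom{n}{k}q^k\beta_k-\beta_n=\begin{cases}q-1 & \text{if } n=0,\\ 1 & \text{if } n=1,\\ 0 & \text{if } n>1.\end{cases}$$ Thus $\beta_0=1$ and $\beta_1=-1/(q+1)$. Let $$\widehat{B}_1(x)=\frac{1}{\beta_1}\sum_{n\ge 0}\beta_{n+1}x^n\in\mathbb{Q}(q)[[x]].$$ Then one has the continued fraction expansion $$\widehat{B}_1(x)=\cfrac{1}{1+\cfrac{c_1x}{1+\cfrac{c_2x}{1+\cfrac{c_3x}{\ddots}}}}$$ whose coefficients are, for all $n\ge 1$, $$c_{2n-1}=\frac{q^n[n]_q^2[n+1]_q}{[2n]_q[2n+1]_q},\qquad c_{2n}=-\frac{[n]_q[n+1]_q^2}{[2n+1]_q[2n+2]_q}.$$ The equality is one of formal power series: the finite continued fractions obtained by truncation converge to $\widehat{B}_1(x)$ in the $x$-adic topology of $\mathbb{Q}(q)[[x]]$,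 i.e. for each $m$ the coefficient of $x^m$ is eventually that of $\widehat{B}_1(x)$. -/

import Mathlib

open scoped PowerSeries

noncomputable section

namespace QBernoulli

/-- The indeterminate `q` of the field `ℚ(q)` of rational functions. -/
abbrev q : RatFunc ℚ := RatFunc.X

/-- The `q`-integer `[n]_q = (q ^ n - 1) / (q - 1)` in `ℚ(q)`. -/
def qInt (n : ℕ) : RatFunc ℚ := (q ^ n - 1) / (q - 1)

/-- The right-hand side `q - 1, 1, 0, 0, …` of Carlitz's relations. -/
def carlitzRhs : ℕ → RatFunc ℚ
  | 0 => q - 1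
  | 1 => 1
  | _ + 2 => 0

/-- Carlitz's relations `q (q β + 1) ^ n - β ^ n = q - 1, 1, 0, 0, …`, where the exponents of `β`
are turned into indices after expanding the binomial. -/
def IsCarlitz (b : ℕ → RatFunc ℚ) : Prop :=
  ∀ n : ℕ,
    q * (∑ k ∈ Finset.range (n + 1), (n.choose k : RatFunc ℚ) * (q ^ k * b k)) - b n = carlitzRhs n

/-- The `q`-Bernoulli-Carlitz numbers `β_n`: Carlitz's `n`-th relation solved for `β_n`
(see `isCarlitz_beta` and `IsCarlitz.eq_beta`). -/
def beta (n : ℕ) : RatFunc ℚ :=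
  (carlitzRhs n - q * ∑ k : Fin n, (n.choose k : RatFunc ℚ) * (q ^ (k : ℕ) * beta k)) /
    (q ^ (n + 1) - 1)
termination_by n
decreasing_by exact k.isLt

lemma q_pow_ne_one (n : ℕ) : q ^ (n + 1) - 1 ≠ 0 := by
  rw [sub_ne_zero]
  intro h
  have h1 : algebraMap (Polynomial ℚ) (RatFunc ℚ) (Polynomial.X ^ (n + 1))
      = algebraMap (Polynomial ℚ) (RatFunc ℚ) 1 := by
    simpa [RatFunc.algebraMap_X] using h
  have h2 := RatFunc.algebraMap_injective ℚ h1
  have h3 := congrArg Polynomial.natDegree h2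
  simp at h3

lemma carlitz_iff (b : ℕ → RatFunc ℚ) (n : ℕ) :
    q * (∑ k ∈ Finset.range (n + 1), (n.choose k : RatFunc ℚ) * (q ^ k * b k)) - b n
        = carlitzRhs n ↔
      b n = (carlitzRhs n - q * ∑ k : Fin n, (n.choose k : RatFunc ℚ) * (q ^ (k : ℕ) * b k)) /
        (q ^ (n + 1) - 1) := by
  rw [Finset.sum_range_succ, eq_div_iff (q_pow_ne_one n),
    Fin.sum_univ_eq_sum_range (fun k => (n.choose k : RatFunc ℚ) * (q ^ k * b k)) n,
    Nat.choose_self]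
  push_cast
  constructor <;> intro h <;> linear_combination h

/-- The numbers `β_n` satisfy Carlitz's relations. -/
theorem isCarlitz_beta : IsCarlitz beta := fun n =>
  (carlitz_iff beta n).2 (by rw [beta])

/-- Carlitz's relations determine the numbers `β_n`. -/
theorem IsCarlitz.eq_beta {b : ℕ → RatFunc ℚ} (hb : IsCarlitz b) : b = beta := by
  funext n
  induction n using Nat.strong_induction_on with
  | _ n ih =>
    rw [(carlitz_iff b n).1 (hb n), (carlitz_iff beta n).1 (isCarlitz_beta n)]
    congr 3
    exact Finset.sum_congr rfl fun k _ => by rw [ih k k.isLt]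

theorem beta_zero : beta 0 = 1 := by
  have h := q_pow_ne_one 0
  rw [beta]
  simp only [carlitzRhs, Finset.univ_eq_empty, Finset.sum_empty, mul_zero, sub_zero, zero_add,
    pow_one] at h ⊢
  exact div_self h

/-- `β_1 = -1 / (q + 1)`. -/
theorem beta_one : beta 1 = -1 / (q + 1) := by
  have h := q_pow_ne_one 1
  have h0 : q - 1 ≠ 0 := by simpa using q_pow_ne_one 0
  have h1 : q + 1 ≠ 0 := fun h1 => h (by linear_combination (q - 1) * h1)
  rw [beta]
  simp only [carlitzRhs, Finset.univ_unique, Fin.default_eq_zero, Finset.sum_singleton,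
    Fin.val_zero, beta_zero, Nat.choose_zero_right, Nat.cast_one, pow_zero, mul_one]
  rw [div_eq_div_iff h h1]
  ring

theorem beta_one_ne_zero : beta 1 ≠ 0 := by
  have h := q_pow_ne_one 1
  have h1 : q + 1 ≠ 0 := fun h1 => h (by linear_combination (q - 1) * h1)
  rw [beta_one]
  exact div_ne_zero (neg_ne_zero.2 one_ne_zero) h1

/-- The shifted ordinary generating series `(1 / β_1) ∑_{n ≥ 0} β_{n+1} x ^ n`, in `ℚ(q)⟦x⟧`. -/
def Bhat₁ : (RatFunc ℚ)⟦X⟧ := PowerSeries.mk fun n => (1 / beta 1) * beta (n + 1)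

end QBernoulli

/-- The finite continued fraction `1 / (1 + c_{j+1} x / (1 + c_{j+2} x / (⋯ / (1 + c_{j+N} x))))`,
as a formal power series in `x`. -/
def sFractionTrunc {K : Type*} [Field K] (c : ℕ → K) (j : ℕ) : ℕ → K⟦X⟧
  | 0 => 1
  | N + 1 => (1 + PowerSeries.C (c (j + 1)) * PowerSeries.X * sFractionTrunc c (j + 1) N)⁻¹

/-- The denominators in `sFractionTrunc` are invertible power series. -/
theorem sFractionTrunc_succ_mul {K : Type*} [Field K] (c : ℕ → K) (j N : ℕ) :
    sFractionTrunc c j (N + 1) *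
      (1 + PowerSeries.C (c (j + 1)) * PowerSeries.X * sFractionTrunc c (j + 1) N) = 1 := by
  rw [sFractionTrunc]
  exact PowerSeries.inv_mul_cancel _ (by simp)

/-- The formal power series `F` equals the infinite continued fraction
`1 / (1 + c_1 x / (1 + c_2 x / (1 + c_3 x / ⋯)))`: its convergents tend to `F` in the `x`-adic
topology, that is, each coefficient is eventually the one of `F`. The value `c 0` is not used. -/
def HasSFraction {K : Type*} [Field K] (F : K⟦X⟧) (c : ℕ → K) : Prop :=
  ∀ m : ℕ, ∀ᶠ N in Filter.atTop,
    PowerSeries.coeff m (sFractionTrunc c 0 N) = PowerSeries.coeff m F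

end

open QBernoulli

/-! ### S-fractions from three-term recurrences. -/

section Fraction

variable {K : Type*} [Field K]

/-! Let `L p = β(x p) / β_1`, where `β` sends `x ^ n` to `β_n`; the coefficients of `Bhat₁` are the
moments of `L`. An S-fraction for them amounts, after even contraction, to polynomials `P_n` with
`P_0 = 1`, `L P_n = 0` for `n > 0`, and a three-term recurrence with coefficients `c_{2n} +
c_{2n+1}` and `c_{2n+1} c_{2n+2}` (`hasSFraction_of_moments`).

Here `P_n` is a multiple of the big q-Jacobi polynomial `₃φ₂(q^{-n}, q^{n+2}, y; q, q²; q, q)` with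
`y = q (1 + (q - 1) x)`, expanded in the basis `risePoly q k`. Its coefficients are `hypCoeff q n
k`, scaled so that `L (x ^ n P_n) = 1`. The recurrence is a rational identity between these
coefficients (`hypSum_recurrence`).

Carlitz's relations say how `β` behaves under `x ↦ q x + 1`, which nearly permutes the `q`-falling
factorials. This evaluates `β` on `x * risePoly q k` as `[k]! / [k+2]` up to sign
(`umbral_fallPoly_mul_risePoly`), and `L P_n = 0` is then a telescoping sum (`hypSum_qFact`). -/

theorem hasSFraction_of_recurrence {c : ℕ → K} {F : K⟦X⟧} (G : ℕ → K⟦X⟧) (h0 : G 0 = 1)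
    (h1 : G 1 = F) (hconst : ∀ j, PowerSeries.constantCoeff (G j) = 1)
    (hrec : ∀ j, G j = G (j + 1) + PowerSeries.C (c (j + 1)) * PowerSeries.X * G (j + 2)) :
    HasSFraction F c := by
  -- The recurrence says that `G (j + 1) / G j` is the fraction's tail from level `j`; each level
  -- contributes one factor `X` to the truncation error.
  have key : ∀ N j, (PowerSeries.X : K⟦X⟧) ^ (N + 1) ∣ sFractionTrunc c j N * G j - G (j + 1) := by
    intro N
    induction N with
    | zero =>
      intro j
      rw [zero_add, pow_one, PowerSeries.X_dvd_iff]
      simp [sFractionTrunc, hconst]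
    | succ N ih =>
      intro j
      obtain ⟨D, hD⟩ := ih (j + 1)
      refine ⟨-(sFractionTrunc c j (N + 1) * PowerSeries.C (c (j + 1)) * D), ?_⟩
      have hS := sFractionTrunc_succ_mul c j N
      rw [hrec j, pow_succ]
      linear_combination G (j + 1) * hS -
        sFractionTrunc c j (N + 1) * PowerSeries.C (c (j + 1)) * PowerSeries.X * hD
  intro m
  filter_upwards [Filter.eventually_ge_atTop m] with N hN
  have h := PowerSeries.X_pow_dvd_iff.1 (key N 0) m (by omega)
  rw [h0, mul_one, zero_add, h1, map_sub] at h
  exact sub_eq_zero.1 h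

/-- A sequence of linear functionals in orthogonality position yields an S-fraction. -/
theorem hasSFraction_of_moments {c : ℕ → K} (μ : ℕ → ℕ → K)
    (hμ0 : μ 0 0 = 1) (hμ : ∀ n, μ (n + 1) 0 = 0)
    (hzero : ∀ s, μ 0 (s + 1) = -c 1 * μ 0 s + c 1 * c 2 * μ 1 s)
    (hsucc : ∀ n s, μ (n + 1) (s + 1) = μ n s - (c (2 * n + 2) + c (2 * n + 3)) * μ (n + 1) s +
      c (2 * n + 3) * c (2 * n + 4) * μ (n + 2) s) :
    HasSFraction (PowerSeries.mk (μ 0)) c := by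
  -- Vanishing at `s = 0` propagates to orthogonality, since the recurrence lowers the degree by at
  -- most one.
  have hlow : ∀ s n, s < n → μ n s = 0 := by
    intro s
    induction s with
    | zero =>
      rintro (_ | n) h
      · omega
      · exact hμ n
    | succ s ih =>
      rintro (_ | n) h
      · omega
      · rw [hsucc, ih n (by omega), ih (n + 1) (by omega), ih (n + 2) (by omega)]
        ring
  have hdiag : ∀ n, μ n n = 1 := by
    intro n
    induction n with
    | zero => exact hμ0
    | succ n ih =>
      rw [hsucc, ih, hlow n (n + 1) (by omega), hlow n (n + 2) (by omega)]
      ring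
  set E : ℕ → K⟦X⟧ := fun n => PowerSeries.mk fun k => μ n (n + k) with hE
  have hEc : ∀ n, PowerSeries.constantCoeff (E n) = 1 := fun n => by
    rw [← PowerSeries.coeff_zero_eq_constantCoeff_apply, hE]
    simp [hdiag]
  have hXE : ∀ n k, PowerSeries.coeff k (PowerSeries.X * E (n + 1)) = μ (n + 1) (n + k) := by
    rintro n (_ | k)
    · simp [hlow n (n + 1) (by omega)]
    · rw [PowerSeries.coeff_succ_X_mul, hE]
      simp only [PowerSeries.coeff_mk]
      congr 1
      omega
  have hX2E : ∀ n k, PowerSeries.coeff k (PowerSeries.X * (PowerSeries.X * E (n + 2))) =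
      μ (n + 2) (n + k) := by
    rintro n (_ | k)
    · simp [hlow n (n + 2) (by omega)]
    · rw [PowerSeries.coeff_succ_X_mul, hXE]
      congr 1
      omega
  have hstart : (1 : K⟦X⟧) = E 0 + PowerSeries.C (c 1) * PowerSeries.X *
      (E 0 - PowerSeries.C (c 2) * PowerSeries.X * E 1) := by
    have : E 0 + PowerSeries.C (c 1) * PowerSeries.X *
      (E 0 - PowerSeries.C (c 2) * PowerSeries.X * E 1) = E 0 + PowerSeries.C (c 1) *
        (PowerSeries.X * E 0) - PowerSeries.C (c 1 * c 2) *
          (PowerSeries.X * (PowerSeries.X * E 1)) := by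
      rw [map_mul]; ring
    rw [this]
    ext (_ | k)
    · simp [hEc]
    · rw [map_sub, map_add, PowerSeries.coeff_C_mul, PowerSeries.coeff_C_mul,
        PowerSeries.coeff_succ_X_mul, PowerSeries.coeff_succ_X_mul, hXE]
      simp only [hE, PowerSeries.coeff_mk, zero_add, PowerSeries.coeff_one]
      rw [hzero, if_neg (by omega)]
      ring
  have hstep : ∀ n, E n - PowerSeries.C (c (2 * n + 2)) * PowerSeries.X * E (n + 1) =
      E (n + 1) + PowerSeries.C (c (2 * n + 3)) * PowerSeries.X *
        (E (n + 1) - PowerSeries.C (c (2 * n + 4)) * PowerSeries.X * E (n + 2)) := by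
    intro n
    suffices h : E (n + 1) = E n - PowerSeries.C (c (2 * n + 2) + c (2 * n + 3)) *
        (PowerSeries.X * E (n + 1)) + PowerSeries.C (c (2 * n + 3) * c (2 * n + 4)) *
          (PowerSeries.X * (PowerSeries.X * E (n + 2))) by
      rw [map_add, map_mul] at h
      linear_combination -h
    ext k
    rw [map_add, map_sub, PowerSeries.coeff_C_mul, PowerSeries.coeff_C_mul, hXE, hX2E]
    simp only [hE, PowerSeries.coeff_mk]
    rw [show n + 1 + k = n + k + 1 by omega, hsucc]
  -- The contraction is undone by interlacing: `G (2 * n) = O n` and `G (2 * n + 1) = E n`.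
  let O : ℕ → K⟦X⟧ := fun n => match n with
    | 0 => 1
    | n + 1 => E n - PowerSeries.C (c (2 * n + 2)) * PowerSeries.X * E (n + 1)
  have hO : ∀ n, O n = E n + PowerSeries.C (c (2 * n + 1)) * PowerSeries.X * O (n + 1) := by
    rintro (_ | n)
    · exact hstart
    · exact hstep n
  refine hasSFraction_of_recurrence (fun j => if Even j then O (j / 2) else E (j / 2))
    (by simp [O]) (by simp [hE]) ?_ ?_
  · intro j
    split_ifs
    · rcases j / 2 with _ | n <;> simp [O, hEc]
    · exact hEc _
  · intro j
    rcases Nat.even_or_odd' j with ⟨n, rfl | rfl⟩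
    · simpa [Nat.even_add_one, show (2 * n + 1) / 2 = n by omega,
        show (2 * n + 2) / 2 = n + 1 by omega, Nat.even_add] using hO n
    · simp [Nat.even_add_one, show (2 * n + 1) / 2 = n by omega,
        show (2 * n + 1 + 1) / 2 = n + 1 by omega, show (2 * n + 1 + 2) / 2 = n + 1 by omega, O]

end Fraction

/-! ### Hypergeometric coefficients and their contiguous relations. -/

section Coefficients

variable {K : Type*} [Field K]

/-- The `q`-integer `[n]_q` in a field. -/
def qNum (q : K) (n : ℕ) : K := (q ^ n - 1) / (q - 1)

/-- The coefficient of `x` in the `2 n + 1`-st level of the continued fraction. -/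
def oddCoeff (q : K) (n : ℕ) : K :=
  q ^ (n + 1) * qNum q (n + 1) ^ 2 * qNum q (n + 2) / (qNum q (2 * n + 2) * qNum q (2 * n + 3))

/-- The coefficient of `x` in the `2 n + 2`-nd level of the continued fraction. -/
def evenCoeff (q : K) (n : ℕ) : K :=
  -(qNum q (n + 1) * qNum q (n + 2) ^ 2) / (qNum q (2 * n + 3) * qNum q (2 * n + 4))

/-- The product of `q ^ (i - n) - 1` for `i < k`. -/
def lowerProd (q : K) (n k : ℕ) : K := ∏ i ∈ Finset.range k, (q ^ i / q ^ n - 1)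

/-- The product of `q ^ (n + i + 2) - 1` for `i < k`. -/
def upperProd (q : K) (n k : ℕ) : K := ∏ i ∈ Finset.range k, (q ^ (n + i + 2) - 1)

/-- The denominators of the hypergeometric coefficients. -/
def denomProd (q : K) (k : ℕ) : K :=
  ∏ i ∈ Finset.range k, ((q ^ (i + 1) - 1) ^ 2 * (q ^ (i + 2) - 1))

/-- The normalisation of the orthogonal polynomials. -/
def normFactor (q : K) (n : ℕ) : K :=
  ∏ i ∈ Finset.range n, (qNum q (2 * i + 3) * qNum q (2 * i + 4) /
    (qNum q (i + 1) ^ 2 * qNum q (i + 2) * q ^ (i + 2)))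

/-- The hypergeometric coefficients of the orthogonal polynomials. -/
def hypCoeff (q : K) (n k : ℕ) : K :=
  normFactor q n * ((q * (q - 1)) ^ k * lowerProd q n k * upperProd q n k / denomProd q k)

variable {q : K}

theorem pow_add_comm' (q : K) (m n : ℕ) : q ^ (m + n) = q ^ n * q ^ m := by
  rw [pow_add, mul_comm]

theorem lowerProd_succ (n k : ℕ) :
    lowerProd q n (k + 1) = lowerProd q n k * (q ^ k / q ^ n - 1) :=
  Finset.prod_range_succ _ _

theorem upperProd_succ (n k : ℕ) :
    upperProd q n (k + 1) = upperProd q n k * (q ^ (n + k + 2) - 1) :=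
  Finset.prod_range_succ _ _

theorem denomProd_succ (k : ℕ) :
    denomProd q (k + 1) = denomProd q k * ((q ^ (k + 1) - 1) ^ 2 * (q ^ (k + 2) - 1)) :=
  Finset.prod_range_succ _ _

theorem normFactor_succ (n : ℕ) :
    normFactor q (n + 1) = normFactor q n * (qNum q (2 * n + 3) * qNum q (2 * n + 4) /
      (qNum q (n + 1) ^ 2 * qNum q (n + 2) * q ^ (n + 2))) :=
  Finset.prod_range_succ _ _

theorem lowerProd_succ_succ (hq : q ≠ 0) (n k : ℕ) :
    lowerProd q (n + 1) (k + 1) = (1 / q ^ (n + 1) - 1) * lowerProd q n k := by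
  rw [lowerProd, Finset.prod_range_succ', lowerProd, mul_comm, pow_zero]
  congr 1
  refine Finset.prod_congr rfl fun i _ => ?_
  rw [pow_succ, pow_succ, mul_div_mul_right _ _ hq]

theorem upperProd_succ' (n k : ℕ) :
    upperProd q n (k + 1) = (q ^ (n + 2) - 1) * upperProd q (n + 1) k := by
  rw [upperProd, Finset.prod_range_succ', upperProd, mul_comm]
  congr 1
  refine Finset.prod_congr rfl fun i _ => ?_
  congr 2
  omega

theorem lowerProd_eq_zero (hq : q ≠ 0) {n k : ℕ} (h : n < k) : lowerProd q n k = 0 :=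
  Finset.prod_eq_zero (Finset.mem_range.2 h) (by rw [div_self (pow_ne_zero _ hq), sub_self])

theorem hypCoeff_eq_zero (hq : q ≠ 0) {n k : ℕ} (h : n < k) : hypCoeff q n k = 0 := by
  rw [hypCoeff, lowerProd_eq_zero hq h]
  ring

theorem hypCoeff_zero_zero : hypCoeff q 0 0 = 1 := by
  simp [hypCoeff, normFactor, lowerProd, upperProd, denomProd]

theorem hypCoeff_succ (n k : ℕ) :
    hypCoeff q n (k + 1) = hypCoeff q n k * (q * (q - 1) * (q ^ k / q ^ n - 1) *
      (q ^ (n + k + 2) - 1) / ((q ^ (k + 1) - 1) ^ 2 * (q ^ (k + 2) - 1))) := by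
  rw [hypCoeff, hypCoeff, lowerProd_succ, upperProd_succ, denomProd_succ, pow_succ,
    mul_assoc (normFactor q n), div_mul_div_comm]
  ring_nf

theorem denomProd_ne_zero (h1 : ∀ n, q ^ (n + 1) - 1 ≠ 0) (k : ℕ) : denomProd q k ≠ 0 :=
  Finset.prod_ne_zero_iff.2 fun i _ => mul_ne_zero (pow_ne_zero _ (h1 i)) (h1 (i + 1))

theorem hypCoeff_recurrence_zero (hq : q ≠ 0) (h1 : ∀ n, q ^ (n + 1) - 1 ≠ 0) (n : ℕ) :
    hypCoeff q n 0 - (evenCoeff q n + oddCoeff q (n + 1)) * hypCoeff q (n + 1) 0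
      + oddCoeff q (n + 1) * evenCoeff q (n + 1) * hypCoeff q (n + 2) 0 =
    - (qNum q 1 / q * hypCoeff q (n + 1) 0) := by
  have e0 := h1 0
  have a1 := h1 n
  have a2 := h1 (n + 1)
  have a3 := h1 (n + 2)
  have a4 := h1 (2 * n + 2)
  have a5 := h1 (2 * n + 3)
  have a6 := h1 (2 * n + 4)
  have a7 := h1 (2 * n + 5)
  clear h1
  simp only [hypCoeff, lowerProd, upperProd, denomProd, Finset.prod_range_zero, pow_zero, mul_one,
    div_one, normFactor_succ, oddCoeff, evenCoeff, qNum]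
  simp only [show 2 * (n + 1) = 2 * n + 2 by ring, add_assoc, Nat.reduceAdd, pow_add_comm' q,
    mul_comm 2 n, pow_mul, pow_one, zero_add] at *
  generalize normFactor q n = T
  have hA : q ^ n ≠ 0 := pow_ne_zero _ hq
  generalize q ^ n = A at *
  field_simp
  ring

theorem hypCoeff_recurrence_one (hq : q ≠ 0) (h1 : ∀ n, q ^ (n + 1) - 1 ≠ 0) (n : ℕ) :
    hypCoeff q n 1 - (evenCoeff q n + oddCoeff q (n + 1)) * hypCoeff q (n + 1) 1
      + oddCoeff q (n + 1) * evenCoeff q (n + 1) * hypCoeff q (n + 2) 1 =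
    hypCoeff q (n + 1) 0 / q - qNum q 2 / q ^ 2 * hypCoeff q (n + 1) 1 := by
  have e0 := h1 0
  have e1 := h1 1
  have a1 := h1 n
  have a2 := h1 (n + 1)
  have a3 := h1 (n + 2)
  have a4 := h1 (2 * n + 2)
  have a5 := h1 (2 * n + 3)
  have a6 := h1 (2 * n + 4)
  have a7 := h1 (2 * n + 5)
  clear h1
  simp only [hypCoeff, lowerProd, upperProd, denomProd, Finset.prod_range_zero,
    Finset.prod_range_one, pow_zero, mul_one, div_one, normFactor_succ, oddCoeff, evenCoeff, qNum]
  simp only [show 2 * (n + 1) = 2 * n + 2 by ring, add_assoc, Nat.reduceAdd, pow_add_comm' q,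
    mul_comm 2 n, pow_mul, pow_one, zero_add] at *
  generalize normFactor q n = T
  have hA : q ^ n ≠ 0 := pow_ne_zero _ hq
  generalize q ^ n = A at *
  field_simp
  ring

/-- From index `k + 2` on, all terms share the factors `lowerProd q n k`, `upperProd q (n + 2) k`
and `1 / denomProd q k`. The indices `0` and `1` lack these factors and are treated separately. -/
theorem hypCoeff_recurrence_add_two (hq : q ≠ 0) (h1 : ∀ n, q ^ (n + 1) - 1 ≠ 0) (n k : ℕ) :
    hypCoeff q n (k + 2) - (evenCoeff q n + oddCoeff q (n + 1)) * hypCoeff q (n + 1) (k + 2)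
      + oddCoeff q (n + 1) * evenCoeff q (n + 1) * hypCoeff q (n + 2) (k + 2) =
    hypCoeff q (n + 1) (k + 1) / q ^ (k + 2) -
      qNum q (k + 3) / q ^ (k + 3) * hypCoeff q (n + 1) (k + 2) := by
  have e0 := h1 0
  have a1 := h1 n
  have a2 := h1 (n + 1)
  have a3 := h1 (n + 2)
  have a4 := h1 (2 * n + 2)
  have a5 := h1 (2 * n + 3)
  have a6 := h1 (2 * n + 4)
  have a7 := h1 (2 * n + 5)
  have b1 := h1 k
  have b2 := h1 (k + 1)
  have b3 := h1 (k + 2)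
  have hD := denomProd_ne_zero h1 k
  clear h1
  have l0 : lowerProd q n (k + 2) = lowerProd q n k * (q ^ k / q ^ n - 1) *
      (q ^ (k + 1) / q ^ n - 1) := by rw [lowerProd_succ, lowerProd_succ]
  have l1 : lowerProd q (n + 1) (k + 1) = (1 / q ^ (n + 1) - 1) * lowerProd q n k :=
    lowerProd_succ_succ hq n k
  have l2 : lowerProd q (n + 1) (k + 2) =
      (1 / q ^ (n + 1) - 1) * (lowerProd q n k * (q ^ k / q ^ n - 1)) := by
    rw [lowerProd_succ_succ hq n (k + 1), lowerProd_succ]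
  have l3 : lowerProd q (n + 2) (k + 2) =
      (1 / q ^ (n + 2) - 1) * ((1 / q ^ (n + 1) - 1) * lowerProd q n k) := by
    rw [lowerProd_succ_succ hq (n + 1) (k + 1), l1]
  have u1 : upperProd q (n + 1) (k + 1) = (q ^ (n + 3) - 1) * upperProd q (n + 2) k :=
    upperProd_succ' (n + 1) k
  have u2 : upperProd q (n + 1) (k + 2) = (q ^ (n + 3) - 1) *
      (upperProd q (n + 2) k * (q ^ (n + 2 + k + 2) - 1)) := by
    rw [upperProd_succ' (n + 1) (k + 1), upperProd_succ]
  have u0 : upperProd q n (k + 2) = (q ^ (n + 2) - 1) *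
      ((q ^ (n + 3) - 1) * upperProd q (n + 2) k) := by
    rw [upperProd_succ' n (k + 1), u1]
  have u3 : upperProd q (n + 2) (k + 2) = upperProd q (n + 2) k *
      (q ^ (n + 2 + k + 2) - 1) * (q ^ (n + 2 + (k + 1) + 2) - 1) := by
    rw [upperProd_succ, upperProd_succ]
  have d1 := denomProd_succ (q := q) k
  have d2 := denomProd_succ (q := q) (k + 1)
  simp only [hypCoeff, l0, l1, l2, l3, u0, u1, u2, u3, d1, d2, normFactor_succ,
    oddCoeff, evenCoeff, qNum]
  clear l0 l1 l2 l3 u0 u1 u2 u3 d1 d2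
  generalize normFactor q n = T
  generalize lowerProd q n k = U
  generalize upperProd q (n + 2) k = V
  generalize denomProd q k = D at *
  simp only [show 2 * (n + 1) = 2 * n + 2 by ring, add_assoc, Nat.reduceAdd, pow_add_comm' q, pow_add_comm' (q * (q - 1)),
       mul_comm 2 n, pow_mul, pow_one, zero_add] at *
  have hA : q ^ n ≠ 0 := pow_ne_zero _ hq
  have hB : q ^ k ≠ 0 := pow_ne_zero _ hq
  have hP : (q * (q - 1)) ^ k ≠ 0 := pow_ne_zero _ (mul_ne_zero hq e0)
  generalize (q * (q - 1)) ^ k = P at *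
  -- With the powers replaced by independent variables, a rational identity remains.
  generalize q ^ n = A at *
  generalize q ^ k = B at *
  field_simp
  ring

end Coefficients

/-! ### Three-term recurrence and orthogonality to constants. -/

section Moments

variable {K : Type*} [Field K] {q : K}

theorem hypCoeff_recurrence_succ (hq : q ≠ 0) (h1 : ∀ n, q ^ (n + 1) - 1 ≠ 0) (n k : ℕ) :
    hypCoeff q n (k + 1) - (evenCoeff q n + oddCoeff q (n + 1)) * hypCoeff q (n + 1) (k + 1)
      + oddCoeff q (n + 1) * evenCoeff q (n + 1) * hypCoeff q (n + 2) (k + 1) =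
    hypCoeff q (n + 1) k / q ^ (k + 1) -
      qNum q (k + 2) / q ^ (k + 2) * hypCoeff q (n + 1) (k + 1) := by
  cases k with
  | zero => simpa using hypCoeff_recurrence_one hq h1 n
  | succ k => exact hypCoeff_recurrence_add_two hq h1 n k

theorem hypCoeff_initial_zero (hq : q ≠ 0) (h1 : ∀ n, q ^ (n + 1) - 1 ≠ 0) :
    -oddCoeff q 0 * hypCoeff q 0 0 + oddCoeff q 0 * evenCoeff q 0 * hypCoeff q 1 0 =
      -(qNum q 1 / q * hypCoeff q 0 0) := by
  have e0 := h1 0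
  have e1 := h1 1
  have e2 := h1 2
  have e3 := h1 3
  clear h1
  simp only [hypCoeff, lowerProd, upperProd, denomProd, Finset.prod_range_zero, pow_zero, mul_one,
    div_one, normFactor, Finset.prod_range_one, oddCoeff, evenCoeff, qNum, zero_add, pow_one,
    mul_zero, Nat.reduceAdd] at *
  field_simp
  ring

theorem hypCoeff_initial_one (hq : q ≠ 0) (h1 : ∀ n, q ^ (n + 1) - 1 ≠ 0) :
    oddCoeff q 0 * evenCoeff q 0 * hypCoeff q 1 1 = hypCoeff q 0 0 / q := by
  have e0 := h1 0
  have e1 := h1 1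
  have e2 := h1 2
  have e3 := h1 3
  clear h1
  simp only [hypCoeff, lowerProd, upperProd, denomProd, Finset.prod_range_zero, pow_zero, mul_one,
    div_one, normFactor, Finset.prod_range_one, oddCoeff, evenCoeff, qNum, zero_add, pow_one,
    mul_zero, Nat.reduceAdd] at *
  field_simp
  ring

theorem hypCoeff_initial_succ (hq : q ≠ 0) (h1 : ∀ n, q ^ (n + 1) - 1 ≠ 0) (k : ℕ) :
    -oddCoeff q 0 * hypCoeff q 0 (k + 1) + oddCoeff q 0 * evenCoeff q 0 * hypCoeff q 1 (k + 1) =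
      hypCoeff q 0 k / q ^ (k + 1) - qNum q (k + 2) / q ^ (k + 2) * hypCoeff q 0 (k + 1) := by
  rw [hypCoeff_eq_zero hq (show 0 < k + 1 by omega)]
  cases k with
  | zero => simpa using hypCoeff_initial_one hq h1
  | succ k =>
    rw [hypCoeff_eq_zero hq (show 0 < k + 1 by omega),
      hypCoeff_eq_zero hq (show 1 < k + 1 + 1 by omega)]
    ring

/-- The value at the orthogonal polynomial of degree `n` of a functional taking the values `f`
on the basis. -/
def hypSum (q : K) (n : ℕ) (f : ℕ → K) : K := ∑ k ∈ Finset.range (n + 1), hypCoeff q n k * f k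

theorem hypSum_eq (hq : q ≠ 0) {n R : ℕ} (h : n < R) (f : ℕ → K) :
    hypSum q n f = ∑ k ∈ Finset.range R, hypCoeff q n k * f k := by
  refine Finset.sum_subset (Finset.range_mono h) fun k _ hk => ?_
  rw [hypCoeff_eq_zero hq (by simpa using hk), zero_mul]

/-- Summation by parts: the left side encodes multiplication by `x` in the basis `risePoly`, which
is moved from the functional to the coefficients. The boundary term at `R` vanishes as `n < R`. -/
theorem hypSum_shift (hq : q ≠ 0) {n R : ℕ} (h : n < R) (f : ℕ → K) :
    hypSum q n (fun k => (f (k + 1) - qNum q (k + 1) * f k) / q ^ (k + 1)) =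
      -(qNum q 1 / q * hypCoeff q n 0) * f 0 + ∑ k ∈ Finset.range R,
        (hypCoeff q n k / q ^ (k + 1) - qNum q (k + 2) / q ^ (k + 2) * hypCoeff q n (k + 1)) *
          f (k + 1) := by
  have h2 := Finset.sum_range_succ
    (fun k => qNum q (k + 1) / q ^ (k + 1) * hypCoeff q n k * f k) R
  rw [Finset.sum_range_succ', hypCoeff_eq_zero hq h] at h2
  rw [hypSum_eq hq h]
  simp only [zero_add, pow_one] at h2
  have h3 : ∑ k ∈ Finset.range R, hypCoeff q n k *
      ((f (k + 1) - qNum q (k + 1) * f k) / q ^ (k + 1)) =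
      ∑ k ∈ Finset.range R, hypCoeff q n k / q ^ (k + 1) * f (k + 1) -
      ∑ k ∈ Finset.range R, qNum q (k + 1) / q ^ (k + 1) * hypCoeff q n k * f k := by
    rw [← Finset.sum_sub_distrib]
    exact Finset.sum_congr rfl fun k _ => by ring
  simp only [sub_mul, Finset.sum_sub_distrib]
  linear_combination h3 + h2

theorem hypSum_recurrence (hq : q ≠ 0) (h1 : ∀ n, q ^ (n + 1) - 1 ≠ 0) (n : ℕ) (f : ℕ → K) :
    hypSum q (n + 1) (fun k => (f (k + 1) - qNum q (k + 1) * f k) / q ^ (k + 1)) =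
      hypSum q n f - (evenCoeff q n + oddCoeff q (n + 1)) * hypSum q (n + 1) f
      + oddCoeff q (n + 1) * evenCoeff q (n + 1) * hypSum q (n + 2) f := by
  rw [hypSum_shift hq (show n + 1 < n + 2 by omega), hypSum_eq hq (show n < n + 3 by omega),
    hypSum_eq hq (show n + 1 < n + 3 by omega), hypSum_eq hq (show n + 2 < n + 3 by omega),
    Finset.mul_sum, Finset.mul_sum, ← Finset.sum_sub_distrib, ← Finset.sum_add_distrib,
    Finset.sum_range_succ' _ (n + 2), ← hypCoeff_recurrence_zero hq h1,
    Finset.sum_congr rfl fun k _ => by rw [← hypCoeff_recurrence_succ hq h1 n k, add_mul, sub_mul]]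
  simp only [mul_assoc]
  ring

theorem hypSum_initial (hq : q ≠ 0) (h1 : ∀ n, q ^ (n + 1) - 1 ≠ 0) (f : ℕ → K) :
    hypSum q 0 (fun k => (f (k + 1) - qNum q (k + 1) * f k) / q ^ (k + 1)) =
      -oddCoeff q 0 * hypSum q 0 f + oddCoeff q 0 * evenCoeff q 0 * hypSum q 1 f := by
  rw [hypSum_shift hq (show 0 < 1 by omega), hypSum_eq hq (show 0 < 2 by omega),
    hypSum_eq hq (show 1 < 2 by omega), Finset.mul_sum, Finset.mul_sum,
    ← Finset.sum_add_distrib, Finset.sum_range_succ' _ 1, ← hypCoeff_initial_zero hq h1,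
    Finset.sum_congr rfl fun k _ => by rw [← hypCoeff_initial_succ hq h1 k, add_mul]]
  simp only [mul_assoc]
  ring

/-- The `q`-factorial. -/
def qFact (q : K) (n : ℕ) : K := ∏ i ∈ Finset.range n, qNum q (i + 1)

theorem qFact_succ (n : ℕ) : qFact q (n + 1) = qFact q n * qNum q (n + 1) :=
  Finset.prod_range_succ _ _

theorem qNum_ne_zero (h1 : ∀ n, q ^ (n + 1) - 1 ≠ 0) (n : ℕ) : qNum q (n + 1) ≠ 0 :=
  div_ne_zero (h1 n) (by simpa using h1 0)

/-- The summand is Gosper-summable: the right side is its antidifference, up to the constant factor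
in front of the sum. -/
theorem sum_hypCoeff_mul_qFact (hq : q ≠ 0) (h1 : ∀ n, q ^ (n + 1) - 1 ≠ 0) (n k : ℕ) :
    (1 - 1 / q ^ n) * (1 - q ^ (n + 2)) *
      ∑ i ∈ Finset.range k, hypCoeff q n i * (qFact q i / qNum q (i + 2)) =
    (q ^ k - 1) * (q ^ (k + 2) - 1) / q ^ k * (hypCoeff q n k * (qFact q k / qNum q (k + 2))) := by
  induction k with
  | zero => simp
  | succ k ih =>
    rw [Finset.sum_range_succ, mul_add, ih, hypCoeff_succ, qFact_succ]
    generalize hypCoeff q n k = T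
    generalize qFact q k = F
    have e0 := h1 0
    have e1 := h1 k
    have e2 := h1 (k + 1)
    have e3 := h1 (k + 2)
    clear ih h1
    simp only [qNum]
    simp only [add_assoc, Nat.reduceAdd, pow_add_comm' q, pow_one, zero_add] at *
    have hA : q ^ n ≠ 0 := pow_ne_zero _ hq
    have hB : q ^ k ≠ 0 := pow_ne_zero _ hq
    generalize q ^ n = A at *
    generalize q ^ k = B at *
    rw [mul_comm _ B] at e1 e2 e3
    field_simp
    ring

theorem hypSum_qFact (hq : q ≠ 0) (h1 : ∀ n, q ^ (n + 1) - 1 ≠ 0) (n : ℕ) :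
    hypSum q (n + 1) (fun k => qFact q k / qNum q (k + 2)) = 0 := by
  have h := sum_hypCoeff_mul_qFact hq h1 (n + 1) (n + 2)
  rw [hypCoeff_eq_zero hq (show n + 1 < n + 2 by omega), zero_mul, mul_zero] at h
  -- The prefactor is nonzero because the degree `n + 1` is positive; in degree `0` it would vanish.
  refine (mul_eq_zero.1 h).resolve_left (mul_ne_zero ?_ ?_)
  · have hA : q ^ (n + 1) ≠ 0 := pow_ne_zero _ hq
    rw [one_sub_div hA]
    exact div_ne_zero (h1 n) hA
  · rw [← neg_sub]
    exact neg_ne_zero.2 (h1 (n + 2))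

end Moments

/-! ### Carlitz's functional on `q`-factorial bases. -/

section Umbral

open Polynomial

variable {K : Type*} [Field K] {q : K}

/-- The linear functional on polynomials with the moments `b`. -/
def umbral (b : ℕ → K) : K[X] →ₗ[K] K := Polynomial.lsum fun n => b n • LinearMap.id

theorem umbral_C_mul_X_pow (b : ℕ → K) (n : ℕ) (a : K) : umbral b (C a * X ^ n) = b n * a := by
  rw [umbral, Polynomial.lsum_apply, C_mul_X_pow_eq_monomial, sum_monomial_index _ _ (by simp)]
  rfl

theorem umbral_X_pow (b : ℕ → K) (n : ℕ) : umbral b (X ^ n) = b n := by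
  simpa using umbral_C_mul_X_pow b n 1

theorem umbral_C_mul (b : ℕ → K) (a : K) (p : K[X]) : umbral b (C a * p) = a * umbral b p := by
  rw [← smul_eq_C_mul, map_smul, smul_eq_mul]

theorem umbral_comp {b : ℕ → K} {r : ℕ → K}
    (hb : ∀ n : ℕ, q * (∑ k ∈ Finset.range (n + 1), (n.choose k : K) * (q ^ k * b k)) - b n = r n)
    (hr0 : r 0 = q - 1) (hr1 : r 1 = 1) (hr : ∀ n, r (n + 2) = 0) (p : K[X]) :
    q * umbral b (p.comp (C q * X + 1)) - umbral b p =
      (q - 1) * p.eval 0 + p.derivative.eval 0 := by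
  induction p using Polynomial.induction_on' with
  | add p p' hp hp' =>
    simp only [add_comp, map_add, eval_add]
    linear_combination hp + hp'
  | monomial n a =>
    have hsum : umbral b ((C q * X + 1) ^ n) =
        ∑ k ∈ Finset.range (n + 1), (n.choose k : K) * (q ^ k * b k) := by
      rw [add_pow, map_sum]
      refine Finset.sum_congr rfl fun k _ => ?_
      rw [one_pow, mul_one, mul_pow, ← C_pow, mul_comm, ← C_eq_natCast, umbral_C_mul, umbral_C_mul,
        umbral_X_pow]
    have hright : (q - 1) * (X ^ n : K[X]).eval 0 + (X ^ n : K[X]).derivative.eval 0 = r n := by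
      rcases n with _ | _ | n <;> simp [hr0, hr1, hr]
    rw [← C_mul_X_pow_eq_monomial, mul_comp, C_comp, X_pow_comp, umbral_C_mul, umbral_C_mul, hsum,
      umbral_X_pow, derivative_C_mul, eval_C_mul, eval_C_mul]
    linear_combination a * hb n - a * hright

/-- The `q`-falling factorial polynomial. -/
noncomputable def fallPoly (q : K) (a : ℕ) : K[X] := ∏ i ∈ Finset.range a, (X - C (qNum q i))

/-- The `q`-rising factorial polynomial. -/
noncomputable def risePoly (q : K) (b : ℕ) : K[X] :=
  ∏ i ∈ Finset.range b, (C (qNum q (i + 1)) + C (q ^ (i + 1)) * X)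

theorem qNum_succ (h1 : q - 1 ≠ 0) (n : ℕ) : qNum q (n + 1) = q * qNum q n + 1 := by
  simp only [qNum]
  field_simp
  ring

theorem fallPoly_succ (a : ℕ) : fallPoly q (a + 1) = fallPoly q a * (X - C (qNum q a)) :=
  Finset.prod_range_succ _ _

theorem risePoly_succ (a : ℕ) : risePoly q (a + 1) =
    risePoly q a * (C (qNum q (a + 1)) + C (q ^ (a + 1)) * X) :=
  Finset.prod_range_succ _ _

/-- Since `[i+1] = q [i] + 1`, the substitution turns `x - [i+1]` into `q (x - [i])`; only the
factor `x` becomes `q x + 1`. -/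
theorem fallPoly_comp (h1 : q - 1 ≠ 0) (a : ℕ) :
    (fallPoly q (a + 1)).comp (C q * X + 1) = C (q ^ a) * fallPoly q a * (C q * X + 1) := by
  induction a with
  | zero => simp [fallPoly, qNum]
  | succ a ih =>
    rw [fallPoly_succ, mul_comp, ih, fallPoly_succ, sub_comp, X_comp, C_comp, qNum_succ h1, pow_succ]
    simp only [C_mul, C_add, C_1]
    ring

theorem fallPoly_derivative_eval_zero (a : ℕ) :
    (fallPoly q (a + 1)).derivative.eval 0 = (-1) ^ a * qFact q a := by
  have h : fallPoly q (a + 1) = (∏ i ∈ Finset.range a, (X - C (qNum q (i + 1)))) * X := by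
    rw [fallPoly, Finset.prod_range_succ']
    simp [qNum]
  rw [h, derivative_mul, derivative_X]
  simp only [eval_add, eval_mul, eval_X, mul_zero, zero_add, mul_one, eval_prod, eval_sub,
    eval_C, zero_sub]
  rw [qFact, Finset.prod_neg]
  simp

theorem fallPoly_eval_zero (a : ℕ) : (fallPoly q (a + 1)).eval 0 = 0 := by
  rw [fallPoly, eval_prod]
  exact Finset.prod_eq_zero (Finset.mem_range.2 a.succ_pos) (by simp [qNum])

theorem umbral_fallPoly {b : ℕ → K} {r : ℕ → K} (h1 : ∀ n, q ^ (n + 1) - 1 ≠ 0)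
    (hb : ∀ n : ℕ, q * (∑ k ∈ Finset.range (n + 1), (n.choose k : K) * (q ^ k * b k)) - b n = r n)
    (hr0 : r 0 = q - 1) (hr1 : r 1 = 1) (hr : ∀ n, r (n + 2) = 0) (a : ℕ) :
    umbral b (fallPoly q a) = (-1) ^ a * qFact q a / qNum q (a + 1) := by
  have e0 : q - 1 ≠ 0 := by simpa using h1 0
  induction a with
  | zero =>
    have h := hb 0
    simp only [zero_add, Finset.range_one, Finset.sum_singleton, Nat.choose_self, Nat.cast_one,
      pow_zero, one_mul, hr0] at h
    have hb0 : b 0 = 1 := mul_left_cancel₀ e0 (by linear_combination h)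
    have := umbral_X_pow b 0
    rw [pow_zero] at this
    simp [fallPoly, this, hb0, qFact, qNum, e0]
  | succ a ih =>
    have h := umbral_comp hb hr0 hr1 hr (fallPoly q (a + 1))
    -- Writing `q x + 1 = q (x - [a]) + [a+1]` makes the functional equation a first-order recursion
    -- in `a`.
    have e : C (q ^ a) * fallPoly q a * (C q * X + 1) =
        C (q ^ (a + 1)) * fallPoly q (a + 1) + C (q ^ a * qNum q (a + 1)) * fallPoly q a := by
      rw [fallPoly_succ, qNum_succ e0, pow_succ]
      simp only [C_mul, C_add, C_1]
      ring
    rw [fallPoly_comp e0, e, map_add, umbral_C_mul, umbral_C_mul, ih, fallPoly_eval_zero,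
      fallPoly_derivative_eval_zero] at h
    have hN := qNum_ne_zero h1 a
    have e2 : q ^ (a + 1 + 1) - 1 = qNum q (a + 1 + 1) * (q - 1) := by
      rw [qNum, div_mul_cancel₀ _ e0]
    have e1 : q ^ (a + 1) - 1 = qNum q (a + 1) * (q - 1) := by
      rw [qNum, div_mul_cancel₀ _ e0]
    rw [eq_div_iff (qNum_ne_zero h1 (a + 1)), qFact_succ]
    rw [mul_div_assoc', mul_add] at h
    apply mul_right_cancel₀ e0
    have h' : q * (q ^ a * qNum q (a + 1) * ((-1) ^ a * qFact q a) / qNum q (a + 1)) =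
        q ^ (a + 1) * ((-1) ^ a * qFact q a) := by
      field_simp
      ring
    rw [h'] at h
    linear_combination h - umbral b (fallPoly q (a + 1)) * e2 - (-1) ^ a * qFact q a * e1

theorem umbral_fallPoly_mul_risePoly {b : ℕ → K} {r : ℕ → K} (h1 : ∀ n, q ^ (n + 1) - 1 ≠ 0)
    (hb : ∀ n : ℕ, q * (∑ k ∈ Finset.range (n + 1), (n.choose k : K) * (q ^ k * b k)) - b n = r n)
    (hr0 : r 0 = q - 1) (hr1 : r 1 = 1) (hr : ∀ n, r (n + 2) = 0) (k a : ℕ) :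
    umbral b (fallPoly q a * risePoly q k) =
      (-1) ^ a * qFact q a * qFact q k / qNum q (a + k + 1) := by
  have e0 : q - 1 ≠ 0 := by simpa using h1 0
  induction k generalizing a with
  | zero => simpa [risePoly, qFact] using umbral_fallPoly h1 hb hr0 hr1 hr a
  | succ k ih =>
    have hN : qNum q (k + 1) + q ^ (k + 1) * qNum q a = qNum q (a + k + 1) := by
      simp only [qNum]
      field_simp
      ring
    -- The new rising factor equals `q^{k+1} (x - [a]) + [a+k+1]`, trading a rising factor for a
    -- falling one; hence the induction is on `k` for all `a`.
    have e : fallPoly q a * risePoly q (k + 1) = C (q ^ (k + 1)) *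
        (fallPoly q (a + 1) * risePoly q k) +
        C (qNum q (a + k + 1)) * (fallPoly q a * risePoly q k) := by
      rw [← hN, fallPoly_succ, risePoly_succ]
      simp only [C_mul, C_add]
      ring
    rw [e, map_add, umbral_C_mul, umbral_C_mul, ih, ih, qFact_succ, qFact_succ,
      mul_div_cancel₀ _ (qNum_ne_zero h1 (a + k))]
    have hN2 : qNum q (k + 1) + q ^ (k + 1) * qNum q (a + 1) = qNum q (a + (k + 1) + 1) := by
      simp only [qNum]
      field_simp
      ring
    have hne := qNum_ne_zero h1 (a + (k + 1))
    rw [show a + 1 + k + 1 = a + (k + 1) + 1 by ring]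
    field_simp
    rw [← hN2]
    ring

end Umbral

/-! ### Assembly for the `q`-Bernoulli–Carlitz numbers. -/

theorem mainTheorem7 (c : ℕ → RatFunc ℚ)
    (hodd : ∀ n : ℕ, 1 ≤ n →
      c (2 * n - 1) = q ^ n * qInt n ^ 2 * qInt (n + 1) / (qInt (2 * n) * qInt (2 * n + 1)))
    (heven : ∀ n : ℕ, 1 ≤ n →
      c (2 * n) = -(qInt n * qInt (n + 1) ^ 2) / (qInt (2 * n + 1) * qInt (2 * n + 2))) :
    HasSFraction Bhat₁ c := by
  have hq : q ≠ 0 := RatFunc.X_ne_zero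
  have h1 := q_pow_ne_one
  have hco : ∀ n, c (2 * n + 1) = oddCoeff q n := fun n => hodd (n + 1) (by omega)
  have hce : ∀ n, c (2 * n + 2) = evenCoeff q n := fun n => heven (n + 1) (by omega)
  have hco' : ∀ n, c (2 * n + 3) = oddCoeff q (n + 1) := fun n => hco (n + 1)
  have hce' : ∀ n, c (2 * n + 4) = evenCoeff q (n + 1) := fun n => hce (n + 1)
  -- `f s k` is `L (x ^ s * risePoly q k)`; the extra power of `X` accounts for the series starting
  -- at `β_1`.
  let f : ℕ → ℕ → RatFunc ℚ := fun s k =>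
    1 / beta 1 * umbral beta (Polynomial.X ^ (s + 1) * risePoly q k)
  have hf : ∀ s, f (s + 1) = fun k => (f s (k + 1) - qNum q (k + 1) * f s k) / q ^ (k + 1) := by
    intro s
    funext k
    rw [eq_div_iff (pow_ne_zero _ hq)]
    have e : Polynomial.X ^ (s + 1) * risePoly q (k + 1) =
        Polynomial.C (q ^ (k + 1)) * (Polynomial.X ^ (s + 1 + 1) * risePoly q k) +
          Polynomial.C (qNum q (k + 1)) * (Polynomial.X ^ (s + 1) * risePoly q k) := by
      rw [risePoly_succ]
      ring
    simp only [f]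
    rw [e, map_add, umbral_C_mul, umbral_C_mul]
    ring
  have hf0 : ∀ k, f 0 k = -1 / beta 1 * (qFact q k / qNum q (k + 2)) := by
    intro k
    have h := umbral_fallPoly_mul_risePoly h1 isCarlitz_beta rfl rfl (fun _ => rfl) k 1
    have hX : fallPoly q 1 = Polynomial.X := by simp [fallPoly, qNum]
    have hone : qFact q 1 = 1 := by
      rw [qFact, Finset.prod_range_one, qNum, zero_add, pow_one]
      exact div_self (by simpa using h1 0)
    rw [hX, hone, show 1 + k + 1 = k + 2 by ring] at h
    simp only [f, zero_add, pow_one]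
    rw [h]
    ring
  have hbase : ∀ s, hypSum q 0 (f s) = 1 / beta 1 * beta (s + 1) := by
    intro s
    rw [hypSum, zero_add, Finset.sum_range_one, hypCoeff_zero_zero, one_mul]
    simp only [f, risePoly, Finset.prod_range_zero, mul_one, umbral_X_pow]
  have hF : Bhat₁ = PowerSeries.mk fun s => hypSum q 0 (f s) := by
    rw [Bhat₁]
    congr 1
    exact funext fun s => (hbase s).symm
  rw [hF]
  refine hasSFraction_of_moments (fun n s => hypSum q n (f s)) ?_ ?_ ?_ ?_
  · rw [hbase]
    exact one_div_mul_cancel beta_one_ne_zero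
  · intro n
    have h := hypSum_qFact hq h1 n
    change hypSum q (n + 1) (f 0) = 0
    rw [hypSum] at h ⊢
    simp only [hf0, mul_left_comm _ (-1 / beta 1)]
    rw [← Finset.mul_sum, h, mul_zero]
  · intro s
    rw [hf s, hypSum_initial hq h1, hce 0, hco 0]
  · intro n s
    rw [hf s, hypSum_recurrence hq h1, hce, hco', hce']
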